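/- Let $K$ be a field and $S=K[x_1,\ldots,x_n]$. For a monomial ideal $J\subset S$ let $G(J)$ be its unique minimal system of monomial generators, and let $d(J)$ be the largest exponent with which some variable $x_k$ occurs in a monomial of $G(J)$ (with $d(J)=0$ if there is none). For $M\neq 0$ a finitely generated multigraded $S$-module, $\operatorname{depth} M$ is the supremum of the lengths of $M$-regular sequences contained in $(x_1,\ldots,x_n)$. Let $I\subset U$ be monomial ideals of $S$ with $d(I)>1$. Let $I_1$ be the ideal generated by $I$ and the monomials obtained from the $u\in G(I)$ by dividing $u$ by $x_i$ for each $i$ with $\deg_{x_i}u=d(I)$, that is, the monomials $$u\Big/\prod_{i:\ \deg_{x_i}u=d(I)}x_i,\qquad u\in G(I).$$ Similarly, let $U_1$ be the ideal generated by $U$ and the monomials $a\big/\prod_{i:\ \deg_{x_i}a=d(I)}x_i$ for $a\in G(U)$ (with the same number $d(I)$). Then $U_1\supset I_1$, and if $U_1\neq I_1$ then $$\operatorname{depth}(U_1/I_1)\ \geq\ \operatorname{depth}(U/I).$$ In particular $\operatorname{depth} S/I_1\geq \operatorname{depth} S/I$. -/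

import Mathlib

namespace MonomialPolarization

/-- A monomial ideal of `K[x₁, …, xₙ]`: an ideal generated by monomials. -/
def IsMonomialIdeal {K : Type*} [Field K] {n : ℕ} (I : Ideal (MvPolynomial (Fin n) K)) : Prop :=
  ∃ A : Set (Fin n →₀ ℕ), I = Ideal.span ((fun a => MvPolynomial.monomial a (1 : K)) '' A)

/-- The set `G(I)`, encoded by exponent vectors: the monomials of `I` that are minimal with
respect to divisibility. For a monomial ideal this is its unique minimal system of monomial
generators. -/
def minGens {K : Type*} [Field K] {n : ℕ} (I : Ideal (MvPolynomial (Fin n) K)) :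
    Set (Fin n →₀ ℕ) :=
  {a | Minimal (fun b => MvPolynomial.monomial b (1 : K) ∈ I) a}

theorem minGens_finite {K : Type*} [Field K] {n : ℕ} (I : Ideal (MvPolynomial (Fin n) K)) :
    (minGens I).Finite :=
  WellQuasiOrderedLE.finite_of_isAntichain (setOfPred_minimal_antichain _)

/-- `d_k(I)`: the highest degree of `x_k` in a monomial of `G(I)` (and `0` if `G(I)` is empty). -/
noncomputable def varDegree {K : Type*} [Field K] {n : ℕ}
    (I : Ideal (MvPolynomial (Fin n) K)) (k : Fin n) : ℕ :=
  (minGens_finite I).toFinset.sup (fun a => a k)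

/-- `d(I) = max_k d_k(I)`. -/
noncomputable def maxVarDegree {K : Type*} [Field K] {n : ℕ}
    (I : Ideal (MvPolynomial (Fin n) K)) : ℕ :=
  Finset.univ.sup (varDegree I)

/-- The exponent vector of `u / ∏ x_i`, the product being over all `i` with `deg_{x_i} u = d`,
where `u` is the monomial with exponent vector `a`. -/
noncomputable def lowerExponent {n : ℕ} (d : ℕ) (a : Fin n →₀ ℕ) : Fin n →₀ ℕ :=
  a - ∑ i ∈ Finset.univ.filter (fun i => a i = d), Finsupp.single i 1

/-- The partial polarization of `U` in degree `d`: the ideal generated by `U` and the monomials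
obtained from `a ∈ G(U)` on dividing by `x_i` for each `i` with `deg_{x_i} a = d`. -/
noncomputable def partialPolarization {K : Type*} [Field K] {n : ℕ} (d : ℕ)
    (U : Ideal (MvPolynomial (Fin n) K)) : Ideal (MvPolynomial (Fin n) K) :=
  U ⊔ Ideal.span ((fun a => MvPolynomial.monomial (lowerExponent d a) (1 : K)) '' minGens U)

/-- The depth of a module `M ≠ 0` over `S = K[x₁, …, xₙ]` (with respect to `(x₁, …, xₙ)`): the
supremum of the lengths of the `M`-regular sequences with all terms in `(x₁, …, xₙ)`. -/
noncomputable def depth {K : Type*} [Field K] {n : ℕ} (M : Type*) [AddCommGroup M]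
    [Module (MvPolynomial (Fin n) K) M] : ℕ∞ :=
  ⨆ rs : {rs : List (MvPolynomial (Fin n) K) //
      (∀ r ∈ rs, r ∈ MvPolynomial.idealOfVars (Fin n) K) ∧ RingTheory.Sequence.IsRegular M rs},
    (rs.1.length : ℕ∞)

end MonomialPolarization

/-! Put `τ d = d + 1` and `τ t = t` otherwise. Writing exponents as `s - 1` with `s ≥ 1`, the
monomial `x^(s-1)` lies in the polarized ideal exactly when `x^(τ s - 1)` lies in the original one
(`isDegreePullback_partialPolarization`). So each multigraded component of `U₁/I₁` is a component of
`U/I`, in a stretched degree.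

Depth is read off from Koszul cohomology. A multigraded strand of the Koszul complex of `x₁, …, xₙ`
on `U₁/I₁` is a strand of the Koszul complex of powers `x_k^(e_k)` on `U/I`, the exponent `e_k`
being the jump of `τ` across that strand. A regular sequence in `(x₁, …, xₙ)` has powers in
`(x_k^(e_k))`, so a sequence of length `p` kills this cohomology below degree `p`
(`koszulExact_of_isWeaklyRegular`). Summing over strands gives the vanishing for `U₁/I₁`
(`koszulExact_of_isDegreePullback`), which yields a weakly regular sequence of length `p` there
(`exists_isWeaklyRegular_of_koszulExact`). It is regular because `U₁/I₁` is not equal to `(x₁, …,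
xₙ)` times itself (`idealOfVars_smul_top_ne_top`). -/

namespace MonomialPolarization

open scoped Pointwise

/-! ### Koszul cohomology and regular elements -/

section Koszul

variable {R : Type*} [CommRing R] {n : ℕ}

/-- The sign with which `k` enters the subset `F` in the Koszul differential. -/
def koszulSign (k : Fin n) (F : Finset (Fin n)) : ℤ :=
  (-1) ^ (F.filter (· < k)).card

/-- The Koszul differential of a family `y` with coefficients in `M`; cochains of degree `i` are
the families indexed by all subsets of `Fin n` that vanish off the subsets of cardinality `i`. -/
def koszulDiff (y : Fin n → R) (M : Type*) [AddCommGroup M] [Module R M] :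
    (Finset (Fin n) → M) →ₗ[R] (Finset (Fin n) → M) :=
  LinearMap.pi fun F =>
    ∑ k ∈ F, (koszulSign k F) • ((y k) • LinearMap.proj (F.erase k))

/-- The families that are cochains of degree `i`. -/
def IsCochain {M : Type*} [Zero M] (i : ℤ) (z : Finset (Fin n) → M) : Prop :=
  ∀ F, (F.card : ℤ) ≠ i → z F = 0

/-- Vanishing of the `i`-th Koszul cohomology of `y` with coefficients in `M`. -/
def KoszulExact (y : Fin n → R) (M : Type*) [AddCommGroup M] [Module R M] (i : ℤ) : Prop :=
  ∀ z : Finset (Fin n) → M, IsCochain i z → koszulDiff y M z = 0 →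
    ∃ w, IsCochain (i - 1) w ∧ koszulDiff y M w = z

theorem koszulSign_mul_self (k : Fin n) (F : Finset (Fin n)) :
    koszulSign k F * koszulSign k F = 1 := by
  rw [koszulSign, ← pow_add, ← two_mul, pow_mul]
  simp

theorem koszulSign_erase_of_not_lt {j k : Fin n} (h : ¬ j < k) (F : Finset (Fin n)) :
    koszulSign k (F.erase j) = koszulSign k F := by
  unfold koszulSign
  congr 2
  ext a
  simp only [Finset.mem_filter, Finset.mem_erase]
  constructor
  · rintro ⟨⟨-, h1⟩, h2⟩
    exact ⟨h1, h2⟩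
  · rintro ⟨h1, h2⟩
    exact ⟨⟨fun e => h (e ▸ h2), h1⟩, h2⟩

theorem koszulSign_insert_of_not_lt {j k : Fin n} (h : ¬ j < k) (F : Finset (Fin n)) :
    koszulSign k (insert j F) = koszulSign k F := by
  rw [← koszulSign_erase_of_not_lt h (insert j F), ← koszulSign_erase_of_not_lt h F,
    Finset.erase_insert_eq_erase]

theorem koszulSign_erase_of_lt {j k : Fin n} (h : j < k) {F : Finset (Fin n)} (hj : j ∈ F) :
    koszulSign k (F.erase j) = - koszulSign k F := by
  have h1 : F.filter (· < k) = insert j ((F.erase j).filter (· < k)) := by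
    ext a
    simp only [Finset.mem_filter, Finset.mem_erase, Finset.mem_insert]
    by_cases e : a = j
    · subst e
      simp [h, hj]
    · simp [e]
  have h2 : j ∉ (F.erase j).filter (· < k) := by simp
  rw [koszulSign, koszulSign, h1, Finset.card_insert_of_notMem h2, pow_succ]
  ring

theorem koszulSign_anticomm {j k : Fin n} (hjk : j ≠ k) {F : Finset (Fin n)} (hj : j ∈ F)
    (hk : k ∈ F) :
    koszulSign k F * koszulSign j (F.erase k) = - (koszulSign j F * koszulSign k (F.erase j)) := by
  rcases lt_or_gt_of_ne hjk with h | h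
  · rw [koszulSign_erase_of_lt h hj, koszulSign_erase_of_not_lt h.not_gt]
    ring
  · rw [koszulSign_erase_of_lt h hk, koszulSign_erase_of_not_lt h.not_gt]
    ring

variable {M N : Type*} [AddCommGroup M] [Module R M] [AddCommGroup N] [Module R N]

theorem koszulDiff_apply (y : Fin n → R) (z : Finset (Fin n) → M) (F : Finset (Fin n)) :
    koszulDiff y M z F = ∑ k ∈ F, koszulSign k F • y k • z (F.erase k) := by
  simp [koszulDiff, LinearMap.sum_apply]

theorem koszulDiff_koszulDiff (y : Fin n → R) (z : Finset (Fin n) → M) :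
    koszulDiff y M (koszulDiff y M z) = 0 := by
  funext F
  simp only [koszulDiff_apply, Finset.smul_sum, Pi.zero_apply]
  rw [Finset.sum_sigma']
  refine Finset.sum_involution (fun p _ => ⟨p.2, p.1⟩) ?_ ?_ ?_ ?_
  · rintro ⟨k, j⟩ h
    simp only [Finset.mem_sigma, Finset.mem_erase] at h
    have hs := koszulSign_anticomm h.2.1 h.2.2 h.1
    simp only
    rw [smul_comm (y k), smul_comm (y j), smul_smul (koszulSign k F), smul_smul (koszulSign j F), hs, Finset.erase_right_comm,
      smul_comm (y j) (y k), neg_smul, neg_add_cancel]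
  · rintro ⟨k, j⟩ h - e
    simp only [Finset.mem_sigma, Finset.mem_erase] at h
    simp only [Sigma.mk.injEq] at e
    exact h.2.1 e.1
  · rintro ⟨k, j⟩ h
    simp only [Finset.mem_sigma, Finset.mem_erase] at h ⊢
    exact ⟨h.2.2, h.2.1.symm, h.1⟩
  · rintro ⟨k, j⟩ h
    rfl

theorem koszulDiff_comp (y : Fin n → R) (f : M →ₗ[R] N) (z : Finset (Fin n) → M) :
    koszulDiff y N (f ∘ z) = f ∘ koszulDiff y M z := by
  funext F
  simp [koszulDiff_apply]

theorem IsCochain.koszulDiff {y : Fin n → R} {z : Finset (Fin n) → M} {i j : ℤ}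
    (h : IsCochain i z) (hj : j = i + 1) : IsCochain j (koszulDiff y M z) := by
  intro F hF
  rw [koszulDiff_apply]
  refine Finset.sum_eq_zero fun k hk => ?_
  have := Finset.card_erase_add_one hk
  rw [h (F.erase k) (by omega), smul_zero, smul_zero]

theorem IsCochain.exists_lift {f : M → N} (hf : Function.Surjective f) {i : ℤ}
    {z : Finset (Fin n) → N} (h : IsCochain i z) (h0 : f 0 = 0) :
    ∃ w : Finset (Fin n) → M, IsCochain i w ∧ f ∘ w = z := by
  refine ⟨fun F => if (F.card : ℤ) = i then (hf (z F)).choose else 0, fun F hF => if_neg hF, ?_⟩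
  funext F
  by_cases hF : (F.card : ℤ) = i
  · simp only [Function.comp_apply, if_pos hF]
    exact (hf (z F)).choose_spec
  · simp only [Function.comp_apply, if_neg hF, h0, h F hF]

/-- Contraction with the `k`-th basis vector. -/
def koszulContract (k : Fin n) (z : Finset (Fin n) → M) : Finset (Fin n) → M :=
  fun F => if k ∈ F then 0 else koszulSign k F • z (insert k F)

/-- Contraction is a homotopy between multiplication by `y k` and zero. -/
theorem koszulDiff_koszulContract (y : Fin n → R) (k : Fin n) (z : Finset (Fin n) → M) :
    koszulDiff y M (koszulContract k z) + koszulContract k (koszulDiff y M z) = y k • z := by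
  funext F
  simp only [Pi.add_apply, Pi.smul_apply, koszulDiff_apply]
  by_cases hk : k ∈ F
  · rw [Finset.sum_eq_single_of_mem k hk]
    · simp only [koszulContract, hk, if_true, Finset.notMem_erase, if_false, Finset.insert_erase,
        add_zero]
      rw [smul_comm (y k), smul_smul, koszulSign_erase_of_not_lt (lt_irrefl k),
        koszulSign_mul_self, one_smul]
    · intro j hj hjk
      simp [koszulContract, hk, hjk.symm]
  · simp only [koszulContract, hk, if_false, koszulDiff_apply, Finset.sum_insert hk,
      Finset.erase_insert hk]
    rw [smul_add, smul_smul, koszulSign_insert_of_not_lt (lt_irrefl k), koszulSign_mul_self,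
      one_smul, add_comm, add_assoc, add_eq_left, Finset.smul_sum, ← Finset.sum_add_distrib]
    refine Finset.sum_eq_zero fun j hj => ?_
    have hjk : j ≠ k := fun e => hk (e ▸ hj)
    have hk' : k ∉ F.erase j := fun h => hk (Finset.mem_of_mem_erase h)
    rw [if_neg hk', Finset.erase_insert_of_ne hjk.symm, smul_comm (y j), smul_smul, smul_smul,
      ← add_smul]
    have hs := koszulSign_anticomm hjk (Finset.mem_insert_of_mem hj) (Finset.mem_insert_self k F)
    rw [Finset.erase_insert hk, koszulSign_insert_of_not_lt (lt_irrefl k),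
      Finset.erase_insert_of_ne hjk.symm, koszulSign_insert_of_not_lt (lt_irrefl k)] at hs
    have e : koszulSign k F * koszulSign j (insert k F) +
        koszulSign j F * koszulSign k (F.erase j) = 0 := by
      have a2 := koszulSign_mul_self j F
      have a3 := koszulSign_mul_self j (insert k F)
      linear_combination (koszulSign j F * koszulSign j (insert k F)) * hs -
        koszulSign k F * koszulSign j (insert k F) * a2 -
        koszulSign j F * koszulSign k (F.erase j) * a3
    rw [e, zero_smul]

/-- The ideal generated by `y` annihilates Koszul cohomology: contraction handles the generators,
linearity the rest. -/
theorem exists_koszulDiff_eq_smul {y : Fin n → R} {c : R} (hc : c ∈ Ideal.span (Set.range y))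
    {i : ℤ} {z : Finset (Fin n) → M} (hz : IsCochain i z) (hd : koszulDiff y M z = 0) :
    ∃ w, IsCochain (i - 1) w ∧ koszulDiff y M w = c • z := by
  induction hc using Submodule.span_induction with
  | mem x hx =>
    obtain ⟨k, rfl⟩ := hx
    refine ⟨koszulContract k z, fun F hF => ?_, ?_⟩
    · unfold koszulContract
      split_ifs with h
      · rfl
      · rw [hz _ (by rw [Finset.card_insert_of_notMem h]; push_cast; omega), smul_zero]
    · rw [← koszulDiff_koszulContract y k z, hd]
      have : koszulContract k (0 : Finset (Fin n) → M) = 0 := by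
        funext F
        simp [koszulContract]
      rw [this, add_zero]
  | zero => exact ⟨0, fun F _ => rfl, by simp⟩
  | add a b _ _ ha hb =>
    obtain ⟨u, hu, hu'⟩ := ha
    obtain ⟨v, hv, hv'⟩ := hb
    refine ⟨u + v, fun F hF => ?_, by rw [map_add, hu', hv', add_smul]⟩
    rw [Pi.add_apply, hu F hF, hv F hF, add_zero]
  | smul a b _ hb =>
    obtain ⟨u, hu, hu'⟩ := hb
    refine ⟨a • u, fun F hF => ?_, by rw [map_smul, hu', smul_eq_mul, mul_smul]⟩
    rw [Pi.smul_apply, hu F hF, smul_zero]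

/-- A cochain whose reduction modulo `r` vanishes is `r` times a cochain. -/
theorem IsCochain.exists_eq_smul {r : R} {i : ℤ} {z : Finset (Fin n) → M} (hz : IsCochain i z)
    (h : (Submodule.mkQ (r • (⊤ : Submodule R M))) ∘ z = 0) :
    ∃ u, IsCochain i u ∧ z = r • u := by
  have h1 : ∀ F, ∃ m : M, r • m = z F := by
    intro F
    have h2 := congrFun h F
    simp only [Function.comp_apply, Pi.zero_apply, Submodule.mkQ_apply,
      Submodule.Quotient.mk_eq_zero] at h2
    obtain ⟨m, -, hm⟩ := (Submodule.mem_smul_pointwise_iff_exists _ _ _).1 h2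
    exact ⟨m, hm⟩
  refine ⟨fun F => if (F.card : ℤ) = i then (h1 F).choose else 0, fun F hF => if_neg hF, ?_⟩
  funext F
  by_cases hF : (F.card : ℤ) = i
  · simp only [Pi.smul_apply, if_pos hF]
    exact (h1 F).choose_spec.symm
  · simp only [Pi.smul_apply, if_neg hF, hz F hF, smul_zero]

/-- In the long exact sequence of `0 → M → M → M/rM → 0`, vanishing of `H^(i-1)(M/rM)` makes `r`
injective on `H^i(M)`, while a power of `r` annihilates it. The induction strips off one factor `r`
at a time. -/
theorem KoszulExact.of_quotSMulTop {y : Fin n → R} {r : R} (hr : IsSMulRegular M r)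
    (hpow : ∃ N : ℕ, r ^ N ∈ Ideal.span (Set.range y)) {i : ℤ}
    (h : KoszulExact y (QuotSMulTop r M) (i - 1)) : KoszulExact y M i := by
  intro z hz hd
  have hreg : ∀ a b : Finset (Fin n) → M, r • a = r • b → a = b := fun a b hab =>
    funext fun F => hr (congrFun hab F)
  obtain ⟨N, hN⟩ := hpow
  have key : ∀ N : ℕ, (∃ w, IsCochain (i - 1) w ∧ koszulDiff y M w = r ^ N • z) →
      ∃ w, IsCochain (i - 1) w ∧ koszulDiff y M w = z := by
    intro N
    induction N with
    | zero => simp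
    | succ N ih =>
      rintro ⟨w, hw, hdw⟩
      refine ih ?_
      set π := Submodule.mkQ (r • (⊤ : Submodule R M)) with hπ
      have hπr : ∀ u : Finset (Fin n) → M, π ∘ (r • u) = 0 := by
        intro u
        funext F
        simp only [hπ, Function.comp_apply, Pi.smul_apply, Pi.zero_apply, Submodule.mkQ_apply,
          Submodule.Quotient.mk_eq_zero]
        exact Submodule.smul_mem_pointwise_smul _ _ _ Submodule.mem_top
      obtain ⟨v, hv, hdv⟩ := h (π ∘ w) (fun F hF => by simp [hw F hF]) (by
        rw [koszulDiff_comp, hdw, pow_succ', mul_smul, hπr])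
      obtain ⟨v, hv', rfl⟩ := hv.exists_lift (Submodule.mkQ_surjective _) (map_zero π)
      rw [koszulDiff_comp] at hdv
      have hc : IsCochain (i - 1) (w - koszulDiff y M v) := by
        intro F hF
        rw [Pi.sub_apply, hw F hF, (hv'.koszulDiff (y := y) (j := i - 1) (by ring)) F hF, sub_zero]
      obtain ⟨u, hu, hwu⟩ := hc.exists_eq_smul (r := r) (by
        funext F
        have := congrFun hdv F
        simp only [Function.comp_apply] at this
        simp only [Function.comp_apply, Pi.sub_apply, map_sub, Pi.zero_apply]
        rw [sub_eq_zero]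
        exact this.symm)
      refine ⟨u, hu, hreg _ _ ?_⟩
      rw [← map_smul, ← hwu, map_sub, koszulDiff_koszulDiff, sub_zero, hdw, pow_succ', mul_smul]
  exact key N (exists_koszulDiff_eq_smul hN hz hd)

/-- Exactness of `H^i(M) → H^i(M/rM) → H^(i+1)(M)`, done on cochains. -/
theorem KoszulExact.quotSMulTop {y : Fin n → R} {r : R} (hr : IsSMulRegular M r) {i : ℤ}
    (h0 : KoszulExact y M i) (h1 : KoszulExact y M (i + 1)) :
    KoszulExact y (QuotSMulTop r M) i := by
  intro z hz hd
  set π := Submodule.mkQ (r • (⊤ : Submodule R M)) with hπ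
  have hreg : ∀ a b : Finset (Fin n) → M, r • a = r • b → a = b := fun a b hab =>
    funext fun F => hr (congrFun hab F)
  obtain ⟨z, hz', rfl⟩ := hz.exists_lift (Submodule.mkQ_surjective _) (map_zero π)
  rw [koszulDiff_comp] at hd
  obtain ⟨w, hw, hzw⟩ := (hz'.koszulDiff (y := y) rfl).exists_eq_smul hd
  obtain ⟨v, hv, rfl⟩ := h1 w hw (hreg _ _ (by
    rw [← map_smul, ← hzw, koszulDiff_koszulDiff, smul_zero]))
  rw [add_sub_cancel_right] at hv
  obtain ⟨u, hu, hdu⟩ := h0 (z - r • v)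
    (fun F hF => by simp [hz' F hF, hv F hF]) (by rw [map_sub, map_smul, hzw, sub_self])
  refine ⟨π ∘ u, fun F hF => by simp [hu F hF], ?_⟩
  rw [koszulDiff_comp, hdu]
  funext F
  simp only [Function.comp_apply, Pi.sub_apply, Pi.smul_apply, map_sub]
  rw [sub_eq_self, hπ, Submodule.mkQ_apply, Submodule.Quotient.mk_eq_zero]
  exact Submodule.smul_mem_pointwise_smul _ _ _ Submodule.mem_top

theorem koszulExact_of_neg (y : Fin n → R) {i : ℤ} (hi : i < 0) : KoszulExact y M i := by
  intro z hz _
  refine ⟨0, fun F _ => rfl, ?_⟩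
  rw [map_zero]
  funext F
  exact (hz F (by omega)).symm

end Koszul

/-! ### Regular sequences versus Koszul vanishing -/

theorem koszulExact_of_isWeaklyRegular {R : Type*} [CommRing R] {n : ℕ} (y : Fin n → R)
    (rs : List R) (hrs : ∀ r ∈ rs, ∃ N : ℕ, r ^ N ∈ Ideal.span (Set.range y))
    {M : Type*} [AddCommGroup M] [Module R M]
    (h : RingTheory.Sequence.IsWeaklyRegular M rs) {i : ℤ} (hi : i < rs.length) :
    KoszulExact y M i := by
  induction rs generalizing M i with
  | nil => exact koszulExact_of_neg y (by simpa using hi)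
  | cons r rs ih =>
    rw [RingTheory.Sequence.isWeaklyRegular_cons_iff] at h
    refine KoszulExact.of_quotSMulTop h.1 (hrs r (by simp)) ?_
    refine ih (fun s hs => hrs s (by simp [hs])) h.2 ?_
    rw [List.length_cons] at hi
    push_cast at hi
    omega

/-- If the ideal consisted of zero divisors, prime avoidance would put it inside an associated
prime, the annihilator of some `m ≠ 0`; then `m`, placed at `∅`, is a nonzero class in degree 0. -/
theorem exists_isSMulRegular_of_koszulExact {R : Type*} [CommRing R] [IsNoetherianRing R] {n : ℕ}
    (y : Fin n → R) (M : Type*) [AddCommGroup M] [Module R M] [Module.Finite R M]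
    (h : KoszulExact y M 0) : ∃ r ∈ Ideal.span (Set.range y), IsSMulRegular M r := by
  by_contra! hcon
  have hsub : (Ideal.span (Set.range y) : Set R) ⊆ ⋃ P ∈ associatedPrimes R M, (P : Set R) := by
    rw [biUnion_associatedPrimes_eq_zero_divisors]
    intro r hr
    have := hcon r hr
    rw [isSMulRegular_iff_right_eq_zero_of_smul] at this
    push Not at this
    obtain ⟨m, hm, hm0⟩ := this
    exact ⟨m, hm0, hm⟩
  -- Prime avoidance exempts two members from being prime; no exemption is needed, so both slots get
  -- the dummy `⊥`.
  obtain ⟨P, hP, hle⟩ := (Ideal.subset_union_prime_finite (associatedPrimes.finite R M)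
    (f := id) ⊥ ⊥ fun P hP _ _ => hP.isPrime).1 hsub
  obtain ⟨hprime, m, hm⟩ := isAssociatedPrime_iff.1 hP
  have hym : ∀ k, y k • m = 0 := by
    intro k
    have h1 : y k ∈ P := hle (Ideal.subset_span ⟨k, rfl⟩)
    rwa [hm, Submodule.mem_colon_singleton, Submodule.mem_bot] at h1
  obtain ⟨w, hw, hdw⟩ := h (Pi.single ∅ m) (fun F hF => by
      rw [Pi.single_eq_of_ne]
      rintro rfl
      simp at hF) (by
    funext F
    rw [koszulDiff_apply]
    refine Finset.sum_eq_zero fun k _ => ?_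
    by_cases hF : F.erase k = ∅
    · rw [hF, Pi.single_eq_same, hym, smul_zero]
    · rw [Pi.single_eq_of_ne hF, smul_zero, smul_zero])
  have hw0 : w = 0 := funext fun F => hw F (by omega)
  have hm0 : m = 0 := by
    have := congrFun hdw ∅
    rw [hw0, map_zero, Pi.single_eq_same] at this
    exact this.symm
  refine hprime.ne_top ((Ideal.eq_top_iff_one _).2 ?_)
  rw [hm, Submodule.mem_colon_singleton, hm0, smul_zero]
  exact Submodule.zero_mem _

theorem exists_isWeaklyRegular_of_koszulExact {R : Type*} [CommRing R] [IsNoetherianRing R] {n : ℕ}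
    (y : Fin n → R) (p : ℕ) {M : Type*} [AddCommGroup M] [Module R M] [Module.Finite R M]
    (h : ∀ i : ℤ, i < p → KoszulExact y M i) :
    ∃ rs : List R, rs.length = p ∧ (∀ r ∈ rs, r ∈ Ideal.span (Set.range y)) ∧
      RingTheory.Sequence.IsWeaklyRegular M rs := by
  induction p generalizing M with
  | zero => exact ⟨[], rfl, by simp, by simp⟩
  | succ p ih =>
    obtain ⟨r, hr, hreg⟩ := exists_isSMulRegular_of_koszulExact y M (h 0 (by positivity))
    obtain ⟨rs, hl, hrs, hw⟩ := ih (M := QuotSMulTop r M) fun i hi =>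
      KoszulExact.quotSMulTop hreg (h i (by push_cast; omega)) (h (i + 1) (by push_cast; omega))
    refine ⟨r :: rs, by simp [hl], ?_, (RingTheory.Sequence.isWeaklyRegular_cons_iff M r rs).2 ⟨hreg, hw⟩⟩
    intro s hs
    rcases List.mem_cons.1 hs with rfl | hs
    · exact hr
    · exact hrs s hs

/-! ### Transfer of Koszul exactness -/

/-- Koszul exactness passes to `N` when each cochain is a finite sum of terms that factor
through Koszul complexes of exact families with coefficients in `M`. -/
theorem KoszulExact.of_factors {R : Type*} [CommRing R] {n : ℕ} {M N : Type*}
    [AddCommGroup M] [Module R M] [AddCommGroup N] [Module R N] {x : Fin n → R} {i : ℤ}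
    {β : Type*} (y : β → Fin n → R) (P : β → Finset (Fin n) → N →+ M)
    (Q : β → Finset (Fin n) → M →+ N)
    (hP : ∀ b F, ∀ k ∈ F, ∀ v, P b F (x k • v) = y b k • P b (F.erase k) v)
    (hQ : ∀ b F, ∀ k ∈ F, ∀ v, Q b F (y b k • v) = x k • Q b (F.erase k) v)
    (hQP : ∀ z : Finset (Fin n) → N, ∃ B : Finset β, ∀ F, ∑ b ∈ B, Q b F (P b F (z F)) = z F)
    (h : ∀ b, KoszulExact (y b) M i) : KoszulExact x N i := by
  intro z hz hd
  have hw : ∀ b, ∃ w, IsCochain (i - 1) w ∧ koszulDiff (y b) M w = fun F => P b F (z F) := by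
    intro b
    refine h b _ (fun F hF => by rw [hz F hF, map_zero]) ?_
    funext F
    have := congrArg (P b F) (congrFun hd F)
    rw [koszulDiff_apply, map_sum, Pi.zero_apply, map_zero] at this
    rw [koszulDiff_apply, Pi.zero_apply, ← this]
    refine Finset.sum_congr rfl fun k hk => ?_
    rw [map_zsmul, hP b F k hk]
  choose w hw hdw using hw
  obtain ⟨B, hB⟩ := hQP z
  refine ⟨∑ b ∈ B, fun F => Q b F (w b F), fun F hF => ?_, ?_⟩
  · rw [Finset.sum_apply]
    exact Finset.sum_eq_zero fun b _ => by rw [hw b F hF, map_zero]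
  · funext F
    rw [map_sum, Finset.sum_apply, ← hB F]
    refine Finset.sum_congr rfl fun b _ => ?_
    rw [← congrFun (hdw b) F, koszulDiff_apply, koszulDiff_apply, map_sum]
    refine Finset.sum_congr rfl fun k hk => ?_
    rw [map_zsmul, hQ b F k hk]

/-- An additive map compatible with two submodules descends to the subquotients. -/
theorem exists_descent {R : Type*} [CommRing R] {M N : Type*} [AddCommGroup M] [Module R M]
    [AddCommGroup N] [Module R N] {U I U' I' : Ideal R} (q : U →ₗ[R] M) (q' : U' →ₗ[R] N)
    (hq : ∀ u : U, q u = 0 ↔ (u : R) ∈ I) (hs : Function.Surjective q')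
    (hq' : ∀ u : U', q' u = 0 ↔ (u : R) ∈ I') (T : R →+ R)
    (hU : ∀ u ∈ U', T u ∈ U) (hI : ∀ u ∈ I', T u ∈ I) :
    ∃ P : N →+ M, ∀ u : U', P (q' u) = q ⟨T u, hU u u.2⟩ := by
  let g : U' →+ M := q.toAddMonoidHom.comp
    { toFun := fun u => ⟨T u, hU u u.2⟩
      map_zero' := by ext; simp
      map_add' := fun a b => by ext; simp }
  have hg : q'.toAddMonoidHom.ker ≤ g.ker := by
    intro u hu
    rw [AddMonoidHom.mem_ker] at hu ⊢
    exact (hq _).2 (hI _ ((hq' u).1 hu))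
  refine ⟨q'.toAddMonoidHom.liftOfSurjective hs ⟨g, hg⟩, fun u => ?_⟩
  exact AddMonoidHom.liftOfRightInverse_comp_apply q'.toAddMonoidHom _
    (Function.rightInverse_surjInv hs) ⟨g, hg⟩ u

/-! ### Moving multigraded components -/

open MvPolynomial

/-- The exponent vector with entries `s k - 1`. -/
noncomputable def predExponent {n : ℕ} (s : Fin n → ℕ) : Fin n →₀ ℕ :=
  Finsupp.equivFunOnFinite.symm fun k => s k - 1

@[simp]
theorem predExponent_apply {n : ℕ} (s : Fin n → ℕ) (k : Fin n) : predExponent s k = s k - 1 :=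
  rfl

open Classical in
/-- The additive map that extracts the component in degree `s - 1` and places it in degree
`t - 1`; it is zero if `s - 1` has a negative entry. -/
noncomputable def moveDegree {K : Type*} [Field K] {n : ℕ} (s t : Fin n → ℕ) :
    MvPolynomial (Fin n) K →+ MvPolynomial (Fin n) K :=
  if ∀ k, 1 ≤ s k then
    (monomial (predExponent t)).toAddMonoidHom.comp (coeffAddMonoidHom (predExponent s))
  else 0

section

variable {K : Type*} [Field K] {n : ℕ}

theorem moveDegree_of_pos {s : Fin n → ℕ} (hs : ∀ k, 1 ≤ s k) (t : Fin n → ℕ)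
    (f : MvPolynomial (Fin n) K) :
    moveDegree s t f = monomial (predExponent t) (coeff (predExponent s) f) := by
  simp [moveDegree, hs]

theorem moveDegree_of_not_pos {s : Fin n → ℕ} (hs : ¬ ∀ k, 1 ≤ s k) (t : Fin n → ℕ)
    (f : MvPolynomial (Fin n) K) : moveDegree s t f = 0 := by
  simp [moveDegree, if_neg hs]

/-- This turns multiplication by `X k ^ e` into multiplication by `X k ^ e'`. If `s` has a zero
entry but `s'` has none, both sides vanish, since the exponent of `X k` in degree `s' - 1` is below
`e`. -/
theorem moveDegree_X_pow_mul {s t s' t' : Fin n → ℕ} {k : Fin n} {e e' : ℕ}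
    (hs : ∀ j, s' j = s j + if j = k then e else 0)
    (ht : ∀ j, t' j = t j + if j = k then e' else 0) (hst : ∀ j, 1 ≤ s j → 1 ≤ t j)
    (f : MvPolynomial (Fin n) K) :
    moveDegree s' t' (X k ^ e * f) = X k ^ e' * moveDegree s t f := by
  have hsingle : ∀ (c : ℕ) (j : Fin n), Finsupp.single k c j = if j = k then c else 0 := by
    intro c j
    rw [Finsupp.single_apply]
    simp only [eq_comm]
  by_cases h : ∀ j, 1 ≤ s j
  · have h' : ∀ j, 1 ≤ s' j := fun j => (h j).trans (by rw [hs]; exact Nat.le_add_right _ _)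
    have e1 : predExponent s' = Finsupp.single k e + predExponent s := by
      ext j
      have := h j
      rw [Finsupp.add_apply, predExponent_apply, predExponent_apply, hs, hsingle]
      omega
    have e2 : predExponent t' = Finsupp.single k e' + predExponent t := by
      ext j
      have := hst j (h j)
      rw [Finsupp.add_apply, predExponent_apply, predExponent_apply, ht, hsingle]
      omega
    rw [moveDegree_of_pos h, moveDegree_of_pos h', X_pow_eq_monomial, X_pow_eq_monomial, e1,
      coeff_monomial_mul, one_mul, monomial_mul, one_mul, e2]
  · rw [moveDegree_of_not_pos h, mul_zero]
    by_cases h' : ∀ j, 1 ≤ s' j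
    · rw [moveDegree_of_pos h', X_pow_eq_monomial, coeff_monomial_mul', if_neg, map_zero]
      intro hle
      push Not at h
      obtain ⟨j, hj⟩ := h
      have h1 := h' j
      have h2 := hle j
      rw [predExponent_apply, hsingle] at h2
      rw [hs] at h1 h2
      split_ifs at h1 h2 <;> omega
    · exact moveDegree_of_not_pos h' _ _

theorem coeff_moveDegree_moveDegree {s t : Fin n → ℕ} (hst : ∀ j, 1 ≤ s j → 1 ≤ t j)
    (f : MvPolynomial (Fin n) K) (c : Fin n →₀ ℕ) :
    coeff c (moveDegree t s (moveDegree s t f)) = if ∀ j, s j = c j + 1 then coeff c f else 0 := by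
  by_cases h : ∀ j, 1 ≤ s j
  · rw [moveDegree_of_pos h, moveDegree_of_pos fun j => hst j (h j), coeff_monomial, coeff_monomial,
      if_pos rfl]
    have : predExponent s = c ↔ ∀ j, s j = c j + 1 := by
      rw [DFunLike.ext_iff]
      refine forall_congr' fun j => ?_
      have := h j
      rw [predExponent_apply]
      omega
    by_cases hc : predExponent s = c
    · rw [if_pos hc, if_pos (this.1 hc), hc]
    · rw [if_neg hc, if_neg fun h' => hc (this.2 h')]
  · rw [moveDegree_of_not_pos h, map_zero, coeff_zero, if_neg]
    exact fun h' => h fun j => by rw [h' j]; omega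

/-- The degree of the component indexed by `F` in the Koszul strand `b`, shifted by `1`. -/
def strandDegree (b : Fin n → ℕ) (F : Finset (Fin n)) : Fin n → ℕ :=
  fun j => b j + if j ∈ F then 1 else 0

theorem exists_sum_moveDegree (τ : ℕ → ℕ) (hτ : ∀ j, 1 ≤ j → 1 ≤ τ j)
    (f : Finset (Fin n) → MvPolynomial (Fin n) K) :
    ∃ B : Finset (Fin n → ℕ), ∀ F, ∑ b ∈ B, moveDegree (τ ∘ strandDegree b F) (strandDegree b F)
      (moveDegree (strandDegree b F) (τ ∘ strandDegree b F) (f F)) = f F := by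
  let N : ℕ := Finset.univ.sup fun F : Finset (Fin n) => (f F).totalDegree
  -- A monomial `c` of `f F` lies in the single strand `b = c + 1 - 1_F`, whose entries are at most
  -- `N + 1`.
  refine ⟨Fintype.piFinset fun _ => Finset.range (N + 2), fun F => ?_⟩
  ext c
  rw [coeff_sum]
  simp only [coeff_moveDegree_moveDegree (s := strandDegree _ F) (t := τ ∘ strandDegree _ F)
    fun j hj => hτ _ hj]
  by_cases hc : coeff c (f F) = 0
  · simp [hc]
  · rw [Finset.sum_eq_single fun j => c j + 1 - if j ∈ F then 1 else 0]
    · rw [if_pos]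
      intro j
      simp only [strandDegree]
      split_ifs <;> omega
    · intro b _ hb
      rw [if_neg]
      intro h
      refine hb (funext fun j => ?_)
      rw [← h j, strandDegree, Nat.add_sub_cancel]
    · intro h
      exfalso
      refine h (Fintype.mem_piFinset.2 fun j => Finset.mem_range.2 ?_)
      have h1 : (f F).totalDegree ≤ N :=
        Finset.le_sup (f := fun F : Finset (Fin n) => (f F).totalDegree) (Finset.mem_univ F)
      have h2 := le_totalDegree (mem_support_iff.2 hc)
      have h3 : c j ≤ c.sum fun _ e => e := by
        rw [Finsupp.sum_fintype _ _ fun _ => rfl]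
        exact Finset.single_le_sum (f := fun i => c i) (fun _ _ => Nat.zero_le _) (Finset.mem_univ j)
      omega

/-! ### Monomial ideals -/

theorem IsMonomialIdeal.mem_iff {I : Ideal (MvPolynomial (Fin n) K)} (hI : IsMonomialIdeal I)
    {f : MvPolynomial (Fin n) K} : f ∈ I ↔ ∀ a ∈ f.support, monomial a (1 : K) ∈ I := by
  obtain ⟨A, rfl⟩ := hI
  simp only [mem_ideal_span_monomial_image]
  refine forall₂_congr fun a _ => ?_
  simp

theorem IsMonomialIdeal.le_iff {I J : Ideal (MvPolynomial (Fin n) K)} (hI : IsMonomialIdeal I)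
    (hJ : IsMonomialIdeal J) :
    I ≤ J ↔ ∀ a, monomial a (1 : K) ∈ I → monomial a (1 : K) ∈ J :=
  ⟨fun h _ ha => h ha, fun h _ hf => hJ.mem_iff.2 fun a ha => h a (hI.mem_iff.1 hf a ha)⟩

theorem mem_minGens {I : Ideal (MvPolynomial (Fin n) K)} {a : Fin n →₀ ℕ} :
    a ∈ minGens I ↔ Minimal (fun b => monomial b (1 : K) ∈ I) a :=
  Iff.rfl

theorem monomial_mem_of_le {I : Ideal (MvPolynomial (Fin n) K)} {a b : Fin n →₀ ℕ} (hab : a ≤ b)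
    (ha : monomial a (1 : K) ∈ I) : monomial b (1 : K) ∈ I := by
  have : monomial b (1 : K) = monomial (b - a) 1 * monomial a 1 := by
    rw [monomial_mul, one_mul, tsub_add_cancel_of_le hab]
  rw [this]
  exact I.mul_mem_left _ ha

theorem monomial_mem_iff {I : Ideal (MvPolynomial (Fin n) K)} {b : Fin n →₀ ℕ} :
    monomial b (1 : K) ∈ I ↔ ∃ a ∈ minGens I, a ≤ b := by
  constructor
  · intro h
    obtain ⟨a, hab, ha⟩ := exists_minimal_le_of_wellFoundedLT
      (fun b => monomial b (1 : K) ∈ I) b h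
    exact ⟨a, ha, hab⟩
  · rintro ⟨a, ha, hab⟩
    exact monomial_mem_of_le hab (mem_minGens.1 ha).prop

theorem IsMonomialIdeal.eq_span_minGens {I : Ideal (MvPolynomial (Fin n) K)}
    (hI : IsMonomialIdeal I) :
    I = Ideal.span ((fun a => monomial a (1 : K)) '' minGens I) := by
  ext f
  rw [hI.mem_iff, mem_ideal_span_monomial_image]
  exact forall₂_congr fun a _ => monomial_mem_iff

theorem isMonomialIdeal_top : IsMonomialIdeal (⊤ : Ideal (MvPolynomial (Fin n) K)) := by
  refine ⟨{0}, ?_⟩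
  rw [eq_comm, Ideal.eq_top_iff_one]
  exact Ideal.subset_span ⟨0, rfl, rfl⟩

theorem IsMonomialIdeal.moveDegree_mem {U V : Ideal (MvPolynomial (Fin n) K)}
    (hU : IsMonomialIdeal U) {s t : Fin n → ℕ}
    (h : (∀ k, 1 ≤ s k) → monomial (predExponent s) (1 : K) ∈ U →
      monomial (predExponent t) (1 : K) ∈ V) {f : MvPolynomial (Fin n) K} (hf : f ∈ U) :
    moveDegree s t f ∈ V := by
  by_cases hs : ∀ k, 1 ≤ s k
  · rw [moveDegree_of_pos hs]
    by_cases hc : coeff (predExponent s) f = 0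
    · rw [hc, map_zero]
      exact V.zero_mem
    · have h1 := h hs (hU.mem_iff.1 hf _ (mem_support_iff.2 hc))
      have h2 := V.mul_mem_left (C (coeff (predExponent s) f)) h1
      rwa [C_mul_monomial, mul_one] at h2
  · rw [moveDegree_of_not_pos hs]
    exact V.zero_mem

/-! ### Degree pullback and comparison of depths -/

/-- Monomial ideals of which the second is the pullback of the first along the monotone
self-map of exponents `t ↦ τ (t + 1) - 1`. -/
def IsDegreePullback (τ : ℕ → ℕ) (U V : Ideal (MvPolynomial (Fin n) K)) : Prop :=
  ∀ s : Fin n → ℕ, (∀ k, 1 ≤ s k) →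
    (monomial (predExponent (τ ∘ s)) (1 : K) ∈ U ↔ monomial (predExponent s) (1 : K) ∈ V)

/-- Moving components from degree `s - 1` to `τ s - 1` and back respects the ideals, hence descends
to `N` and `M`. Shifted degree 0 stands for the empty degree `-1`; `h0` and `hpos` make `τ` preserve
both emptiness and nonemptiness. -/
theorem koszulExact_of_isDegreePullback {U I U' I' : Ideal (MvPolynomial (Fin n) K)}
    {M N : Type*} [AddCommGroup M] [Module (MvPolynomial (Fin n) K) M] [AddCommGroup N]
    [Module (MvPolynomial (Fin n) K) N] (q : U →ₗ[MvPolynomial (Fin n) K] M)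
    (q' : U' →ₗ[MvPolynomial (Fin n) K] N) (hs : Function.Surjective q)
    (hq : ∀ u : U, q u = 0 ↔ (u : MvPolynomial (Fin n) K) ∈ I) (hs' : Function.Surjective q')
    (hq' : ∀ u : U', q' u = 0 ↔ (u : MvPolynomial (Fin n) K) ∈ I')
    (hU : IsMonomialIdeal U) (hI : IsMonomialIdeal I) (hU' : IsMonomialIdeal U')
    (hI' : IsMonomialIdeal I') {τ : ℕ → ℕ} (hmono : Monotone τ) (h0 : τ 0 = 0)
    (hpos : ∀ t, 1 ≤ t → 1 ≤ τ t) (hUU' : IsDegreePullback τ U U')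
    (hII' : IsDegreePullback τ I I') {i : ℤ}
    (h : ∀ e : Fin n → ℕ, KoszulExact (fun k => (X k : MvPolynomial (Fin n) K) ^ e k) M i) :
    KoszulExact (X : Fin n → MvPolynomial (Fin n) K) N i := by
  have hpos' : ∀ t, 1 ≤ τ t → 1 ≤ t := by
    intro t ht
    by_contra hcon
    obtain rfl : t = 0 := by omega
    omega
  have hT : ∀ {V V' : Ideal (MvPolynomial (Fin n) K)}, IsMonomialIdeal V' →
      IsDegreePullback τ V V' → ∀ s, ∀ f ∈ V', moveDegree s (τ ∘ s) f ∈ V :=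
    fun hV' hVV' s f hf => hV'.moveDegree_mem (fun hs => (hVV' s hs).2) hf
  have hR : ∀ {V V' : Ideal (MvPolynomial (Fin n) K)}, IsMonomialIdeal V →
      IsDegreePullback τ V V' → ∀ s, ∀ f ∈ V, moveDegree (τ ∘ s) s f ∈ V' :=
    fun hV hVV' s f hf => hV.moveDegree_mem (fun hs => (hVV' s fun k => hpos' _ (hs k)).1) hf
  have hP := fun s => exists_descent q q' hq hs' hq' (moveDegree s (τ ∘ s)) (hT hU' hUU' s)
    (hT hI' hII' s)
  have hQ := fun s => exists_descent q' q hq' hs hq (moveDegree (τ ∘ s) s) (hR hU hUU' s)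
    (hR hI hII' s)
  choose P hP using hP
  choose Q hQ using hQ
  have hdeg : ∀ (b : Fin n → ℕ) (F : Finset (Fin n)), ∀ k ∈ F, ∀ j,
      strandDegree b F j = strandDegree b (F.erase k) j + if j = k then 1 else 0 := by
    intro b F k hk j
    by_cases hjk : j = k
    · subst hjk
      simp [strandDegree, hk]
    · simp [strandDegree, hjk]
  have hdeg' : ∀ (b : Fin n → ℕ) (F : Finset (Fin n)), ∀ k ∈ F, ∀ j,
      (τ ∘ strandDegree b F) j = (τ ∘ strandDegree b (F.erase k)) j +
        if j = k then τ (b k + 1) - τ (b k) else 0 := by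
    intro b F k hk j
    by_cases hjk : j = k
    · subst hjk
      have := hmono (Nat.le_add_right (b j) 1)
      simp only [Function.comp_apply, strandDegree, hk, if_true, Finset.notMem_erase, if_false,
        add_zero]
      omega
    · simp [strandDegree, hjk]
  -- Adding `k` to `F` raises the shifted degree from `b k` to `b k + 1` in `N`, hence from `τ (b
  -- k)` to `τ (b k + 1)` in `M`.
  refine KoszulExact.of_factors (fun (b : Fin n → ℕ) k => X k ^ (τ (b k + 1) - τ (b k)))
    (fun b F => P (strandDegree b F)) (fun b F => Q (strandDegree b F)) ?_ ?_ ?_ fun b => h _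
  · intro b F k hk v
    obtain ⟨u, rfl⟩ := hs' v
    rw [← map_smul, hP, hP, ← map_smul]
    congr 1
    ext1
    have := moveDegree_X_pow_mul (hdeg b F k hk) (hdeg' b F k hk) (fun j hj => hpos _ hj)
      (u : MvPolynomial (Fin n) K)
    rw [pow_one] at this
    exact this
  · intro b F k hk v
    obtain ⟨u, rfl⟩ := hs v
    rw [← map_smul, hQ, hQ, ← map_smul]
    congr 1
    ext1
    have := moveDegree_X_pow_mul (hdeg' b F k hk) (hdeg b F k hk) (fun j hj => hpos' _ hj)
      (u : MvPolynomial (Fin n) K)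
    rw [pow_one] at this
    exact this
  · intro z
    choose u hu using fun F => hs' (z F)
    obtain ⟨B, hB⟩ := exists_sum_moveDegree τ hpos fun F => (u F : MvPolynomial (Fin n) K)
    refine ⟨B, fun F => ?_⟩
    simp only [← hu F, hP, hQ]
    rw [← map_sum]
    congr 1
    ext1
    rw [Submodule.coe_sum]
    exact hB F

/-- Some minimal generator `c` of `U` lies outside `I`. By minimality, elements of `(x₁, …, xₙ) U`
have zero coefficient at `c`, so the class of `c` cannot come from one of them. -/
theorem idealOfVars_smul_top_ne_top {U I : Ideal (MvPolynomial (Fin n) K)} {M : Type*}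
    [AddCommGroup M] [Module (MvPolynomial (Fin n) K) M] (q : U →ₗ[MvPolynomial (Fin n) K] M)
    (hs : Function.Surjective q) (hq : ∀ u : U, q u = 0 ↔ (u : MvPolynomial (Fin n) K) ∈ I)
    (hU : IsMonomialIdeal U) (hI : IsMonomialIdeal I) (hUI : ¬ U ≤ I) :
    idealOfVars (Fin n) K • (⊤ : Submodule (MvPolynomial (Fin n) K) M) ≠ ⊤ := by
  obtain ⟨c, hc, hcI⟩ : ∃ c ∈ minGens U, monomial c (1 : K) ∉ I := by
    by_contra! hcon
    refine hUI ((hU.le_iff hI).2 fun a ha => ?_)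
    obtain ⟨c, hc, hca⟩ := monomial_mem_iff.1 ha
    exact monomial_mem_of_le hca (hcon c hc)
  have hvars : ∀ r ∈ idealOfVars (Fin n) K, coeff 0 r = 0 := by
    intro r hr
    have hle : idealOfVars (Fin n) K ≤ RingHom.ker (constantCoeff (R := K) (σ := Fin n)) := by
      rw [Ideal.span_le]
      rintro _ ⟨k, rfl⟩
      simp
    exact hle hr
  have key : ∀ v ∈ idealOfVars (Fin n) K • (⊤ : Submodule (MvPolynomial (Fin n) K) M),
      ∃ u : U, q u = v ∧ coeff c (u : MvPolynomial (Fin n) K) = 0 := by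
    intro v hv
    induction hv using Submodule.smul_induction_on' with
    | smul r hr v _ =>
      obtain ⟨u, rfl⟩ := hs v
      refine ⟨r • u, map_smul _ _ _, ?_⟩
      rw [Submodule.coe_smul, smul_eq_mul, coeff_mul]
      refine Finset.sum_eq_zero ?_
      rintro ⟨a, b⟩ hab
      have hab := Finset.HasAntidiagonal.mem_antidiagonal.1 hab
      simp only at hab ⊢
      by_cases ha : a = 0
      · rw [ha, hvars r hr, zero_mul]
      · suffices coeff b (u : MvPolynomial (Fin n) K) = 0 by rw [this, mul_zero]
        by_contra hb
        have h1 := hU.mem_iff.1 u.2 b (mem_support_iff.2 hb)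
        have h2 : c ≤ b := (mem_minGens.1 hc).le_of_le h1 (by rw [← hab]; exact le_add_self)
        refine ha ?_
        have h3 : a + b ≤ 0 + b := by simpa [hab] using h2
        exact le_antisymm (le_of_add_le_add_right h3) zero_le
    | add v _ w _ hv hw =>
      obtain ⟨a, rfl, ha⟩ := hv
      obtain ⟨b, rfl, hb⟩ := hw
      exact ⟨a + b, map_add _ _ _, by rw [Submodule.coe_add, coeff_add, ha, hb, add_zero]⟩
  intro htop
  obtain ⟨u, hu, hcu⟩ := key (q ⟨monomial c 1, (mem_minGens.1 hc).prop⟩) (by rw [htop]; exact Submodule.mem_top)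
  rw [eq_comm, ← sub_eq_zero, ← map_sub, hq] at hu
  refine hcI (hI.mem_iff.1 hu c (mem_support_iff.2 ?_))
  simp [hcu]

theorem depth_le_depth_of_isDegreePullback {U I U' I' : Ideal (MvPolynomial (Fin n) K)}
    {M N : Type*} [AddCommGroup M] [Module (MvPolynomial (Fin n) K) M] [AddCommGroup N]
    [Module (MvPolynomial (Fin n) K) N] (q : U →ₗ[MvPolynomial (Fin n) K] M)
    (q' : U' →ₗ[MvPolynomial (Fin n) K] N) (hs : Function.Surjective q)
    (hq : ∀ u : U, q u = 0 ↔ (u : MvPolynomial (Fin n) K) ∈ I) (hs' : Function.Surjective q')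
    (hq' : ∀ u : U', q' u = 0 ↔ (u : MvPolynomial (Fin n) K) ∈ I')
    (hU : IsMonomialIdeal U) (hI : IsMonomialIdeal I) (hU' : IsMonomialIdeal U')
    (hI' : IsMonomialIdeal I') {τ : ℕ → ℕ} (hmono : Monotone τ) (h0 : τ 0 = 0)
    (hpos : ∀ t, 1 ≤ t → 1 ≤ τ t) (hUU' : IsDegreePullback τ U U')
    (hII' : IsDegreePullback τ I I') (hne : ¬ U' ≤ I') :
    depth (K := K) (n := n) M ≤ depth (K := K) (n := n) N := by
  refine iSup_le ?_
  rintro ⟨rs, hmem, hreg⟩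
  have : Module.Finite (MvPolynomial (Fin n) K) N := Module.Finite.of_surjective q' hs'
  -- Every variable lies in the radical of `(x_k^(e_k))`; exponents `e k = 0` do no harm, as the
  -- ideal is then the whole ring.
  have hpow : ∀ e : Fin n → ℕ, ∀ r ∈ rs, ∃ N : ℕ,
      r ^ N ∈ Ideal.span (Set.range fun k => (X k : MvPolynomial (Fin n) K) ^ e k) := by
    intro e r hr
    have hle : idealOfVars (Fin n) K ≤
        (Ideal.span (Set.range fun k => (X k : MvPolynomial (Fin n) K) ^ e k)).radical := by
      rw [Ideal.span_le]
      rintro _ ⟨k, rfl⟩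
      exact ⟨e k, Ideal.subset_span ⟨k, rfl⟩⟩
    exact hle (hmem r hr)
  obtain ⟨rs', hlen, hmem', hreg'⟩ := exists_isWeaklyRegular_of_koszulExact
    (X : Fin n → MvPolynomial (Fin n) K) rs.length (M := N) fun i hi =>
      koszulExact_of_isDegreePullback q q' hs hq hs' hq' hU hI hU' hI' hmono h0 hpos hUU' hII'
        fun e => koszulExact_of_isWeaklyRegular _ rs (hpow e) hreg.toIsWeaklyRegular hi
  have htop : (⊤ : Submodule (MvPolynomial (Fin n) K) N) ≠ Ideal.ofList rs' • ⊤ := by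
    intro h
    refine idealOfVars_smul_top_ne_top q' hs' hq' hU' hI' hne (top_le_iff.1 ?_)
    exact h.le.trans (Submodule.smul_mono (Ideal.span_le.2 hmem') le_rfl)
  rw [← hlen]
  exact le_iSup (fun rs : {rs : List (MvPolynomial (Fin n) K) //
    (∀ r ∈ rs, r ∈ idealOfVars (Fin n) K) ∧ RingTheory.Sequence.IsRegular N rs} =>
      (rs.1.length : ℕ∞)) ⟨rs', hmem', hreg', htop⟩

/-! ### Partial polarization as a degree pullback -/

theorem lowerExponent_apply (d : ℕ) (a : Fin n →₀ ℕ) (j : Fin n) :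
    lowerExponent d a j = a j - if a j = d then 1 else 0 := by
  rw [lowerExponent, Finsupp.tsub_apply, Finsupp.finsetSum_apply]
  simp [Finsupp.single_apply, Finset.sum_ite_eq']

theorem partialPolarization_eq_span (d : ℕ) {U : Ideal (MvPolynomial (Fin n) K)}
    (hU : IsMonomialIdeal U) :
    partialPolarization d U = Ideal.span ((fun a => monomial a (1 : K)) ''
      (minGens U ∪ lowerExponent d '' minGens U)) := by
  rw [Set.image_union, Ideal.span_union, ← hU.eq_span_minGens, Set.image_image]
  rfl

theorem isMonomialIdeal_partialPolarization (d : ℕ) {U : Ideal (MvPolynomial (Fin n) K)}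
    (hU : IsMonomialIdeal U) : IsMonomialIdeal (partialPolarization d U) :=
  ⟨_, partialPolarization_eq_span d hU⟩

/-- Lowering entries `d` of a generator to `d - 1` is adjoint to raising entries `d - 1` of the
tested exponent to `d`. The generators of `U` themselves add nothing, being multiples of their
lowered forms. -/
theorem isDegreePullback_partialPolarization (d : ℕ) {U : Ideal (MvPolynomial (Fin n) K)}
    (hU : IsMonomialIdeal U) :
    IsDegreePullback (fun t => if t = d then d + 1 else t) U (partialPolarization d U) := by
  intro s hs
  have hle : ∀ a : Fin n →₀ ℕ, lowerExponent d a ≤ predExponent s ↔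
      a ≤ predExponent ((fun t => if t = d then d + 1 else t) ∘ s) := by
    intro a
    simp only [Finsupp.le_def]
    refine forall_congr' fun j => ?_
    have := hs j
    simp only [lowerExponent_apply, predExponent_apply, Function.comp_apply]
    split_ifs <;> omega
  rw [partialPolarization_eq_span d hU, mem_ideal_span_monomial_image, monomial_mem_iff]
  have hsupp : (monomial (predExponent s) (1 : K)).support = {predExponent s} := by
    classical
    rw [support_monomial, if_neg one_ne_zero]
  rw [hsupp]
  simp only [Finset.mem_singleton, forall_eq]
  constructor
  · rintro ⟨a, ha, h⟩
    exact ⟨lowerExponent d a, Or.inr ⟨a, ha, rfl⟩, (hle a).2 h⟩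
  · rintro ⟨_, ha | ⟨a, ha, rfl⟩, h⟩
    · refine ⟨_, ha, (hle _).1 (le_trans (fun j => ?_) h)⟩
      rw [lowerExponent_apply]
      exact Nat.sub_le _ _
    · exact ⟨a, ha, (hle a).1 h⟩

theorem IsDegreePullback.mono {τ : ℕ → ℕ} {U V U' V' : Ideal (MvPolynomial (Fin n) K)}
    (hU : IsDegreePullback τ U U') (hV : IsDegreePullback τ V V') (hUV : U ≤ V)
    (hU' : IsMonomialIdeal U') (hV' : IsMonomialIdeal V') : U' ≤ V' := by
  refine (hU'.le_iff hV').2 fun a ha => ?_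
  have e : predExponent (fun k => a k + 1) = a := by
    ext k
    simp
  rw [← e] at ha ⊢
  exact (hV _ fun k => by omega).1 (hUV ((hU _ fun k => by omega).2 ha))

/-- Since `d ≠ 1`, `τ` fixes 1, so `1 ∈ I₁` would give `1 ∈ I`, against a minimal generator with an
exponent above 1. -/
theorem partialPolarization_ne_top {I : Ideal (MvPolynomial (Fin n) K)} (hI : IsMonomialIdeal I)
    (hd : 1 < maxVarDegree I) : partialPolarization (maxVarDegree I) I ≠ ⊤ := by
  intro htop
  obtain ⟨k, -, hk⟩ := Finset.lt_sup_iff.1 hd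
  obtain ⟨a, ha, hak⟩ := Finset.lt_sup_iff.1 hk
  rw [Set.Finite.mem_toFinset] at ha
  have h := (isDegreePullback_partialPolarization (maxVarDegree I) hI (fun _ => 1)
    fun _ => le_rfl).2 (htop ▸ Submodule.mem_top)
  have e : predExponent ((fun t => if t = maxVarDegree I then maxVarDegree I + 1 else t) ∘
      fun _ : Fin n => 1) = 0 := by
    ext j
    simp [hd.ne]
  rw [e] at h
  have := (mem_minGens.1 ha).le_of_le h zero_le k
  rw [Finsupp.zero_apply] at this
  omega

end

end MonomialPolarization

theorem mainTheorem8 {K : Type*} [Field K] {n : ℕ} (I U : Ideal (MvPolynomial (Fin n) K))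
    (hI : MonomialPolarization.IsMonomialIdeal I) (hU : MonomialPolarization.IsMonomialIdeal U)
    (hIU : I ≤ U) (hd : 1 < MonomialPolarization.maxVarDegree I)
    (I₁ U₁ : Ideal (MvPolynomial (Fin n) K))
    (hI₁ : I₁ = MonomialPolarization.partialPolarization (MonomialPolarization.maxVarDegree I) I)
    (hU₁ : U₁ = MonomialPolarization.partialPolarization (MonomialPolarization.maxVarDegree I) U) :
    I₁ ≤ U₁ ∧
    (U₁ ≠ I₁ →
      MonomialPolarization.depth (K := K) (n := n) (U ⧸ Submodule.submoduleOf I U) ≤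
        MonomialPolarization.depth (K := K) (n := n) (U₁ ⧸ Submodule.submoduleOf I₁ U₁)) ∧
    MonomialPolarization.depth (K := K) (n := n) (MvPolynomial (Fin n) K ⧸ I) ≤
      MonomialPolarization.depth (K := K) (n := n) (MvPolynomial (Fin n) K ⧸ I₁) := by
  open MonomialPolarization in
  have hpI := isDegreePullback_partialPolarization (maxVarDegree I) hI
  have hpU := isDegreePullback_partialPolarization (maxVarDegree I) hU
  have hmI := isMonomialIdeal_partialPolarization (maxVarDegree I) hI
  have hmU := isMonomialIdeal_partialPolarization (maxVarDegree I) hU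
  have htop := partialPolarization_ne_top hI hd
  rw [← hI₁] at hpI hmI htop
  rw [← hU₁] at hpU hmU
  set d := maxVarDegree I
  have hle : I₁ ≤ U₁ := hpI.mono hpU hIU hmI hmU
  have hmono : Monotone fun t => if t = d then d + 1 else t := by
    intro a b hab
    simp only
    split_ifs <;> omega
  have h0 : (if 0 = d then d + 1 else 0) = 0 := if_neg (by omega)
  have hpos : ∀ t, 1 ≤ t → 1 ≤ if t = d then d + 1 else t := by
    intro t ht
    split_ifs <;> omega
  refine ⟨hle, fun hne => ?_, ?_⟩
  · have hker : ∀ V J : Ideal (MvPolynomial (Fin n) K), ∀ u : V,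
        (Submodule.submoduleOf J V).mkQ u = 0 ↔ (u : MvPolynomial (Fin n) K) ∈ J := by
      intro V J u
      rw [Submodule.mkQ_apply, Submodule.Quotient.mk_eq_zero]
      rfl
    exact depth_le_depth_of_isDegreePullback (Submodule.mkQ _) (Submodule.mkQ _)
      (Submodule.mkQ_surjective _) (hker U I) (Submodule.mkQ_surjective _) (hker U₁ I₁) hU hI hmU
      hmI hmono h0 hpos hpU hpI fun h => hne (le_antisymm h hle)
  -- `S/J` is presented as a quotient of the unit ideal, which is its own degree pullback.
  · let q : ∀ J : Ideal (MvPolynomial (Fin n) K), (⊤ : Ideal (MvPolynomial (Fin n) K))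
        →ₗ[MvPolynomial (Fin n) K] MvPolynomial (Fin n) K ⧸ J := fun J =>
      (Submodule.mkQ J).comp (Submodule.subtype ⊤)
    have hsurj : ∀ J, Function.Surjective (q J) := by
      intro J v
      obtain ⟨u, rfl⟩ := Submodule.mkQ_surjective J v
      exact ⟨⟨u, Submodule.mem_top⟩, rfl⟩
    have hker : ∀ J, ∀ u : (⊤ : Ideal (MvPolynomial (Fin n) K)),
        q J u = 0 ↔ (u : MvPolynomial (Fin n) K) ∈ J := fun J u =>
      Submodule.Quotient.mk_eq_zero J
    exact depth_le_depth_of_isDegreePullback (q I) (q I₁) (hsurj I) (hker I) (hsurj I₁) (hker I₁)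
      isMonomialIdeal_top hI isMonomialIdeal_top hmI hmono h0 hpos
      (fun s _ => iff_of_true Submodule.mem_top Submodule.mem_top) hpI
      fun h => htop (top_le_iff.1 h)
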